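/- For a class $\mathcal F$ of functions $X\to\mathbb R$ and $\epsilon>0$, define three dimensions in $\{0,1,2,\dots,\infty\}$ (all equal to $0$ for the empty class). * $\mathrm{fat}(\mathcal F,\epsilon)$ is the largest $d$ such that there are distinct $x_1,\dots,x_d\in X$ and $\theta_1,\dots,\theta_d\in\mathbb R$ such that for every $b\in\{0,1\}^d$ some $f\in\mathcal F$ satisfies $f(x_j)\ge\theta_j+\epsilon$ whenever $b_j=1$ and $f(x_j)\le\theta_j$ whenever $b_j=0$. * $\mathrm{sfat}(\mathcal F,\epsilon)$ is the largest depth $d$ of a complete binary tree whose internal nodes $v$ are labelled by points $x(v)\in X$ and witnesses $\theta(v)\in\mathbb R$ and whose leaves $\ell$ are labelled by $f_\ell\in\mathcal F$, such that for every root-to-leaf path $v_1,\dots,v_d,v_{d+1}=\ell$ and every $i\le d$: $f_\ell(x(v_i))\ge\theta(v_i)+\epsilon$ if $v_{i+1}$ is the left child of $v_i$, and $f_\ell(x(v_i))\le\theta(v_i)$ if it is the right child. * $\mathrm{fatr}(\mathcal F,\epsilon)$ is the largest $d$ such that there are distinct $f_1,\dots,f_d\in\mathcal F$, distinct $x_1,\dots,x_d\in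 X$ and $\theta\in\mathbb R$ with $f_i(x_j)\ge\theta+\epsilon$ for $i\le j$ and $f_i(x_j)\le\theta$ for $i>j$. Let $G$ be a $k$-player game with action sets $\mathcal A_1,\dots,\mathcal A_k$ (arbitrary sets), profiles $\mathcal A=\prod_p\mathcal A_p$ and utilities $u_p:\mathcal A\to[0,1]$. Let $\mathcal F_p=\{x\mapsto u_p(x,a_{-p}) : a_{-p}\in\prod_{q\ne p}\mathcal A_q\}$, a class over $\mathcal A_p$, and put $\mathrm{fat}(G,\epsilon)=\max_p\mathrm{fat}(\mathcal F_p,\epsilon)$, and likewise $\mathrm{sfat}(G,\epsilon)$ and $\mathrm{fatr}(G,\epsilon)$. The CCE matrix of $G$ is $$M[a,(p,d_p)]=u_p(d_p,a_{-p})-u_p(a_p,a_{-p}),\qquad a\in\mathcal A,\ p\in\{1,\dots,k\},\ d_p\in\mathcal A_p,$$ viewed as the class of its rows $M[a,\cdot]$ over the disjoint union of the sets $\mathcal A_p$. There is a universal constant $C>0$ such that for every $k$, every such game $G$ and every $\epsilon>0$: 1. if $\mathrm{fat}(G,\epsilon)<\infty$ and $D=\max(\mathrm{fat}(G,\epsilon),2)$,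 then $\mathrm{fat}(M,16\epsilon)\le C\,k\,D\,\log D\,\log^2(1/\epsilon)$; 2. $\mathrm{sfat}(M,2\epsilon)\le C\,\dfrac{k}{\epsilon}\,\max(\mathrm{sfat}(G,\epsilon),1)$; 3. if $\epsilon\le 1$, then $\mathrm{fatr}(M,2\epsilon)\le\dfrac{k}{\epsilon}\,\mathrm{fatr}(G,\epsilon)$. -/

import Mathlib

universe v

/-! Combinatorial dimensions of real-valued function classes. A function class over a domain `X`
is a set of functions `X → ℝ`; dimensions take values in `ℕ∞`, and the dimension of the empty
class is `0`. -/

/-- `F` shatters some `d`-element subset `{x₁, …, x_d}` of `X` with margin `ε`, with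
witnesses `θ₁, …, θ_d`. -/
def FatShatters {X : Type*} (F : Set (X → ℝ)) (ε : ℝ) (d : ℕ) : Prop :=
  ∃ (x : Fin d → X) (θ : Fin d → ℝ), Function.Injective x ∧
    ∀ b : Fin d → Bool, ∃ f ∈ F, ∀ j : Fin d,
      (b j = true → θ j + ε ≤ f (x j)) ∧ (b j = false → f (x j) ≤ θ j)

/-- The `ε`-fat-shattering dimension. -/
noncomputable def fatDim {X : Type*} (F : Set (X → ℝ)) (ε : ℝ) : ℕ∞ :=
  ⨆ (d : ℕ) (_ : FatShatters F ε d), (d : ℕ∞)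

/-- A labelled complete binary tree of depth `d`. A node at depth `i` is the sequence of the `i`
turns that lead to it from the root (`true` is left, `false` is right). Internal nodes (depth
`< d`) carry a point of `X` and a witness, leaves (depth `d`) carry a function. -/
structure LabelledTree (X : Type*) (d : ℕ) where
  point : (i : Fin d) → (Fin i → Bool) → X
  witness : (i : Fin d) → (Fin i → Bool) → ℝ
  leaf : (Fin d → Bool) → X → ℝ

/-- The internal node at depth `i` on the root-to-leaf path that ends in the leaf `b`. -/
def nodeOnPath {d : ℕ} (b : Fin d → Bool) (i : Fin d) : Fin i → Bool :=
  fun j => b ⟨j, j.isLt.trans i.isLt⟩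

/-- The leaves of the tree are in `F`, and along every root-to-leaf path the function at the leaf
is at least the witness plus `ε` where the path turns left, and at most the witness where it
turns right. -/
def LabelledTree.IsShattered {X : Type*} {d : ℕ} (T : LabelledTree X d) (F : Set (X → ℝ))
    (ε : ℝ) : Prop :=
  (∀ b : Fin d → Bool, T.leaf b ∈ F) ∧
  ∀ (b : Fin d → Bool) (i : Fin d),
    (b i = true →
      T.witness i (nodeOnPath b i) + ε ≤ T.leaf b (T.point i (nodeOnPath b i))) ∧
    (b i = false →
      T.leaf b (T.point i (nodeOnPath b i)) ≤ T.witness i (nodeOnPath b i))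

/-- The `ε`-sequential-fat-shattering dimension. -/
noncomputable def sfatDim {X : Type*} (F : Set (X → ℝ)) (ε : ℝ) : ℕ∞ :=
  ⨆ (d : ℕ) (_ : ∃ T : LabelledTree X d, T.IsShattered F ε), (d : ℕ∞)

/-- `F` contains an `ε`-fat threshold pattern of size `d`, with one common witness `θ`. -/
def FatThresholds {X : Type*} (F : Set (X → ℝ)) (ε : ℝ) (d : ℕ) : Prop :=
  ∃ (f : Fin d → X → ℝ) (x : Fin d → X) (θ : ℝ),
    Function.Injective f ∧ Function.Injective x ∧ (∀ i, f i ∈ F) ∧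
    ∀ i j : Fin d, (i ≤ j → θ + ε ≤ f i (x j)) ∧ (j < i → f i (x j) ≤ θ)

/-- The `ε`-fat-threshold dimension. -/
noncomputable def fatrDim {X : Type*} (F : Set (X → ℝ)) (ε : ℝ) : ℕ∞ :=
  ⨆ (d : ℕ) (_ : FatThresholds F ε d), (d : ℕ∞)

/-- A `k`-player game: a set of actions and a utility function for each player. -/
structure Game (k : ℕ) where
  Action : Fin k → Type v
  utility : Fin k → ((p : Fin k) → Action p) → ℝ

namespace Game

/-- Action profiles. -/
abbrev Profile {k : ℕ} (G : Game k) := (p : Fin k) → G.Action p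

/-- Actions of all the players but `p`. -/
abbrev Others {k : ℕ} (G : Game k) (p : Fin k) := (q : {q : Fin k // q ≠ p}) → G.Action q

/-- `a₋ₚ`, the actions in `a` of all the players but `p`. -/
def others {k : ℕ} (G : Game k) (p : Fin k) (a : G.Profile) : G.Others p := fun q => a q

/-- The profile `(x, b)` in which `p` plays `x` and the other players play `b`. -/
def combine {k : ℕ} (G : Game k) (p : Fin k) (x : G.Action p) (b : G.Others p) : G.Profile :=
  (Equiv.piSplitAt p G.Action).symm (x, b)

/-- The utility class of player `p`: the functions `x ↦ uₚ(x, b)` on the actions of `p`, one for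
each choice `b` of actions of the other players. -/
def utilityClass {k : ℕ} (G : Game k) (p : Fin k) : Set (G.Action p → ℝ) :=
  Set.range fun (b : G.Others p) (x : G.Action p) => G.utility p (G.combine p x b)

/-- The dimension of a game is the maximum of the dimensions of its utility classes. -/
noncomputable def fat {k : ℕ} (G : Game k) (ε : ℝ) : ℕ∞ := ⨆ p, fatDim (G.utilityClass p) ε

noncomputable def sfat {k : ℕ} (G : Game k) (ε : ℝ) : ℕ∞ := ⨆ p, sfatDim (G.utilityClass p) ε

noncomputable def fatr {k : ℕ} (G : Game k) (ε : ℝ) : ℕ∞ := ⨆ p, fatrDim (G.utilityClass p) ε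

/-- The CCE matrix: its entry at `(a, (p, x))` is the gain of `p` from deviating to `x` at the
profile `a`. -/
def cceMatrix {k : ℕ} (G : Game k) (a : G.Profile) (y : Σ p, G.Action p) : ℝ :=
  G.utility y.1 (G.combine y.1 y.2 (G.others y.1 a)) - G.utility y.1 a

/-- The rows of the CCE matrix as a function class over the disjoint union of the action sets. -/
def cceClass {k : ℕ} (G : Game k) : Set ((Σ p, G.Action p) → ℝ) := Set.range G.cceMatrix

end Game

/-! On the columns of player `p`, the row of the CCE matrix at `a` is a member of the utility class
of `p` shifted by the constant `u_p(a)`. If a set of rows has all its shifts in a window of length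
`ε`, then one shift of the witness turns margin `2ε` for the matrix into margin `ε` for the utility
class. So each bound splits columns by player (the factor `k`) and rows by utility level (about
`1/ε` windows).

For thresholds this is pigeonhole (`card_player_fatThresholds_le`). For fat shattering, Sauer–Shelah
bounds the sign patterns within each level, so `2 ^ n` is at most the number of levels times a
binomial sum (`two_pow_card_player_le`). For trees, each pair of a player and a level gets a
Littlestone-type rank. At every node some child has a strictly smaller total rank, so the total
bounds the depth (`le_sum_treeRank_of_treeShatters_cceMatrix`). -/

theorem ENat.toENNReal_iSup_prop_le {P : ℕ → Prop} {R : ENNReal}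
    (h : ∀ d, P d → (d : ENNReal) ≤ R) :
    ((⨆ (d : ℕ) (_ : P d), (d : ℕ∞) : ℕ∞) : ENNReal) ≤ R := by
  simp only [ENat.toENNReal_iSup, ENat.toENNReal_coe]
  exact iSup₂_le h

theorem ENat.le_of_iSup_iSup_prop_eq {ι : Sort*} {P : ι → ℕ → Prop} {r : ℕ}
    (h : (⨆ (p : ι) (d : ℕ) (_ : P p d), (d : ℕ∞)) = r) {p : ι} {d : ℕ} (hd : P p d) : d ≤ r := by
  have : (d : ℕ∞) ≤ ⨆ (p : ι) (d : ℕ) (_ : P p d), (d : ℕ∞) :=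
    le_iSup_of_le p (le_iSup₂_of_le d hd le_rfl)
  rw [h] at this
  exact_mod_cast this

/-! ### Fat thresholds -/

namespace Game

variable {k : ℕ} (G : Game.{v} k)

/-- The utility of `p` at the profile `a` after `p` deviates to `x`. -/
def deviation (p : Fin k) (a : G.Profile) (x : G.Action p) : ℝ :=
  G.utility p (G.combine p x (G.others p a))

theorem deviation_mem_utilityClass (p : Fin k) (a : G.Profile) :
    G.deviation p a ∈ G.utilityClass p := ⟨G.others p a, rfl⟩

theorem range_deviation_subset (p : Fin k) : Set.range (G.deviation p) ⊆ G.utilityClass p := by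
  rintro _ ⟨a, rfl⟩
  exact G.deviation_mem_utilityClass p a

theorem cceMatrix_mk (a : G.Profile) (p : Fin k) (x : G.Action p) :
    G.cceMatrix a ⟨p, x⟩ = G.deviation p a x - G.utility p a := rfl

/-- A threshold pattern of the CCE matrix, restricted to columns of one player and to rows at which
the utility of that player varies by at most `ε`, is a threshold pattern of the utility class. -/
theorem fatThresholds_utilityClass {n : ℕ} {ε θ v : ℝ} (hε : 0 < ε) (a : Fin n → G.Profile)
    (x : Fin n → Σ p, G.Action p) (hx : Function.Injective x)
    (h : ∀ i j : Fin n, (i ≤ j → θ + 2 * ε ≤ G.cceMatrix (a i) (x j)) ∧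
      (j < i → G.cceMatrix (a i) (x j) ≤ θ))
    (p : Fin k) (T : Finset (Fin n)) (hp : ∀ j ∈ T, (x j).1 = p)
    (hv : ∀ j ∈ T, v ≤ G.utility p (a j) ∧ G.utility p (a j) ≤ v + ε) :
    FatThresholds (G.utilityClass p) ε T.card := by
  let e := T.orderEmbOfFin rfl
  have he : ∀ t, e t ∈ T := fun t => T.orderEmbOfFin_mem rfl t
  have hy : ∀ t, ∃ y : G.Action p, x (e t) = ⟨p, y⟩ := by
    intro t
    have := hp _ (he t)
    generalize x (e t) = z at *
    obtain ⟨q, z⟩ := z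
    subst this
    exact ⟨z, rfl⟩
  choose y hy using hy
  -- Adding a utility in `[v, v + ε]` puts high entries above `θ + v + 2ε` and low ones below `θ + v
  -- + ε`.
  have key : ∀ i j, (i ≤ j → (θ + v + ε) + ε ≤ G.deviation p (a (e i)) (y j)) ∧
      (j < i → G.deviation p (a (e i)) (y j) ≤ θ + v + ε) := by
    intro i j
    obtain ⟨h1, h2⟩ := h (e i) (e j)
    rw [hy, cceMatrix_mk] at h1 h2
    have := hv _ (he i)
    refine ⟨fun hij => ?_, fun hij => ?_⟩
    · linarith [h1 (e.monotone hij)]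
    · linarith [h2 (e.strictMono hij)]
  refine ⟨fun i => G.deviation p (a (e i)), y, θ + v + ε, ?_, ?_,
    fun i => G.deviation_mem_utilityClass p _, key⟩
  -- Distinct CCE rows may come from the same utility function, so distinctness is read off the
  -- pattern: rows `i < j` are separated by column `i`.
  · have : ∀ i j, i < j → G.deviation p (a (e i)) ≠ G.deviation p (a (e j)) := by
      intro i j hij heq
      have h1 := (key i i).1 le_rfl
      have h2 := (key j i).2 hij
      rw [heq] at h1
      linarith
    intro i j hij
    by_contra hne
    rcases lt_or_gt_of_ne hne with hlt | hlt
    · exact this _ _ hlt hij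
    · exact this _ _ hlt hij.symm
  · intro i j hij
    apply e.injective
    apply hx
    rw [hy, hy, hij]

/-- The columns of one player in a threshold pattern of the CCE matrix. -/
theorem card_player_fatThresholds_le (hu : ∀ p a, G.utility p a ∈ Set.Icc (0 : ℝ) 1)
    {n r : ℕ} {ε θ : ℝ} (hε : 0 < ε) (hε1 : ε ≤ 1) (a : Fin n → G.Profile)
    (x : Fin n → Σ p, G.Action p) (hx : Function.Injective x)
    (h : ∀ i j : Fin n, (i ≤ j → θ + 2 * ε ≤ G.cceMatrix (a i) (x j)) ∧
      (j < i → G.cceMatrix (a i) (x j) ≤ θ))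
    (p : Fin k) (hr : ∀ d, FatThresholds (G.utilityClass p) ε d → d ≤ r)
    (S : Finset (Fin n)) (hp : ∀ j ∈ S, (x j).1 = p) :
    (S.card : ℝ) ≤ r / ε := by
  rw [le_div_iff₀ hε]
  rcases S.eq_empty_or_nonempty with rfl | hS
  · simp
  have hbd : ∀ i, ∀ j ∈ S, -G.utility p (a i) ≤ G.cceMatrix (a i) (x j) ∧
      G.cceMatrix (a i) (x j) ≤ 1 - G.utility p (a i) := by
    intro i j hj
    have := hp j hj
    generalize x j = z at *
    obtain ⟨q, z⟩ := z
    subst this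
    have h1 : G.deviation q (a i) z ∈ Set.Icc (0 : ℝ) 1 := hu _ _
    rw [cceMatrix_mk]
    constructor <;> linarith [h1.1, h1.2]
  set i₀ := S.min' hS
  have hi₀ : i₀ ∈ S := S.min'_mem hS
  -- A single index is a pattern of size one; `1 ≤ r` later absorbs the index `i₀` that is set
  -- aside.
  have hr1 : 1 ≤ r := by
    have := hr _ (G.fatThresholds_utilityClass hε a x hx h p {i₀}
      (by simpa using hp _ hi₀) (v := G.utility p (a i₀)) (by simp [hε.le]))
    simpa using this
  have hr1' : (1 : ℝ) ≤ r := by exact_mod_cast hr1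
  -- Row `i` has a high entry at column `i` and a low one at column `i₀`, both in `[-u, 1 - u]`.
  -- Hence `0 ≤ u + θ ≤ 1 - 2ε`, which saves two levels and gives the sharp constant.
  have hrange : ∀ i ∈ S.erase i₀, 0 ≤ (G.utility p (a i) + θ) / ε ∧
      (G.utility p (a i) + θ) / ε + 2 ≤ 1 / ε := by
    intro i hi
    obtain ⟨hne, hi⟩ := Finset.mem_erase.1 hi
    have hlt : i₀ < i := lt_of_le_of_ne (S.min'_le i hi) (Ne.symm hne)
    have h1 := (h i i).1 le_rfl
    have h2 := (h i i₀).2 hlt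
    have h3 := hbd i i hi
    have h4 := hbd i i₀ hi₀
    refine ⟨div_nonneg (by linarith) hε.le, ?_⟩
    rw [div_add' _ _ _ hε.ne']
    gcongr
    linarith
  set B := ⌊1 / ε⌋₊ - 1 with hB
  have hcard : (S.erase i₀).card ≤ r * B := by
    have := Finset.card_le_mul_card_image_of_maps_to (s := S.erase i₀) (t := Finset.range B)
      (f := fun i => ⌊(G.utility p (a i) + θ) / ε⌋₊) ?_ r ?_
    · simpa using this
    · intro i hi
      obtain ⟨h0, h1⟩ := hrange i hi
      have h2 := Nat.floor_le_floor h1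
      have h3 := Nat.floor_add_natCast h0 2
      push_cast at h3
      rw [h3] at h2
      rw [Finset.mem_range]
      omega
    · intro c _
      refine hr _ (G.fatThresholds_utilityClass hε a x hx h p _ ?_ (v := c * ε - θ) ?_)
      · intro j hj
        exact hp j (Finset.mem_of_mem_erase (Finset.mem_filter.1 hj).1)
      · intro j hj
        obtain ⟨hj, hc⟩ := Finset.mem_filter.1 hj
        have h0 := (hrange j hj).1
        obtain ⟨h1, h2⟩ := (Nat.floor_eq_iff h0).1 hc
        rw [le_div_iff₀ hε] at h1
        rw [div_lt_iff₀ hε] at h2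
        constructor <;> linarith
  rw [Finset.card_erase_of_mem hi₀] at hcard
  by_cases hS1 : S.card ≤ 1
  · have : (S.card : ℝ) ≤ 1 := by exact_mod_cast hS1
    nlinarith
  have hBpos : 1 ≤ B := by
    by_contra hB0
    have : B = 0 := by omega
    rw [this] at hcard
    omega
  have hB1 : (B : ℝ) + 1 ≤ 1 / ε := by
    have h1 : B + 1 = ⌊1 / ε⌋₊ := by omega
    have h2 := Nat.floor_le (a := 1 / ε) (by positivity)
    rw [← h1] at h2
    exact_mod_cast h2
  have hcard' : (S.card : ℝ) ≤ r * B + 1 := by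
    have : S.card ≤ r * B + 1 := by omega
    exact_mod_cast this
  rw [le_div_iff₀ hε] at hB1
  have hB0 : (0 : ℝ) ≤ B := by positivity
  nlinarith [mul_le_mul_of_nonneg_left hB1 (by linarith : (0 : ℝ) ≤ r)]

theorem fatrDim_cceClass_le (hu : ∀ p a, G.utility p a ∈ Set.Icc (0 : ℝ) 1)
    {ε : ℝ} (hε : 0 < ε) (hε1 : ε ≤ 1) :
    (fatrDim G.cceClass (2 * ε) : ENNReal) ≤ ENNReal.ofReal (k / ε) * (G.fatr ε : ENNReal) := by
  refine ENat.toENNReal_iSup_prop_le fun n hn => ?_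
  obtain ⟨f, x, θ, -, hx, hf, h⟩ := hn
  choose a ha using hf
  obtain rfl : f = fun i => G.cceMatrix (a i) := funext fun i => (ha i).symm
  rcases Nat.eq_zero_or_pos k with rfl | hk
  -- The case `k = 0` is separate because `0 * ⊤ = 0`; with `k > 0` an infinite dimension makes the
  -- bound trivial.
  · obtain rfl : n = 0 := by
      by_contra hn
      exact (x ⟨0, Nat.pos_of_ne_zero hn⟩).1.elim0
    simp
  by_cases htop : G.fatr ε = ⊤
  · have : 0 < (k : ℝ) / ε := by positivity
    simp [htop, ENNReal.mul_top, this]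
  obtain ⟨r, hr⟩ := ENat.ne_top_iff_exists.1 htop
  have hr' : ∀ p d, FatThresholds (G.utilityClass p) ε d → d ≤ r := fun p d hd =>
    ENat.le_of_iSup_iSup_prop_eq hr.symm hd
  rw [← hr, ENat.toENNReal_coe, ← ENNReal.ofReal_natCast, ← ENNReal.ofReal_natCast (n := r),
    ← ENNReal.ofReal_mul (by positivity)]
  apply ENNReal.ofReal_le_ofReal
  have hsum := Finset.card_eq_sum_card_fiberwise (s := (Finset.univ : Finset (Fin n)))
    (t := (Finset.univ : Finset (Fin k))) (f := fun j => (x j).1) (by simp)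
  rw [Finset.card_univ, Fintype.card_fin] at hsum
  calc (n : ℝ) = ∑ p : Fin k, ((Finset.univ.filter fun j => (x j).1 = p).card : ℝ) := by
        exact_mod_cast hsum
    _ ≤ ∑ _p : Fin k, (r : ℝ) / ε := Finset.sum_le_sum fun p _ =>
        G.card_player_fatThresholds_le hu hε hε1 a x hx h p (hr' p) _ (by simp)
    _ = k / ε * r := by
        simp
        ring

end Game

/-! ### Shattered trees and their rank -/

/-- The functions `F a`, `a ∈ A`, shatter a complete binary tree of depth `d` with margin `ε`:
a recursive form of `LabelledTree.IsShattered`. -/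
def TreeShatters {ι X : Type*} (F : ι → X → ℝ) (ε : ℝ) : ℕ → Set ι → Prop
  | 0, A => A.Nonempty
  | d + 1, A => ∃ x θ, TreeShatters F ε d {a ∈ A | θ + ε ≤ F a x} ∧
      TreeShatters F ε d {a ∈ A | F a x ≤ θ}

section TreeShatters

variable {ι X : Type*} {F : ι → X → ℝ} {ε : ℝ}

theorem TreeShatters.mono : ∀ {d : ℕ} {A B : Set ι}, A ⊆ B → TreeShatters F ε d A →
    TreeShatters F ε d B
  | 0, _, _, h, hA => Set.Nonempty.mono h hA
  | _ + 1, _, _, h, ⟨x, θ, h1, h2⟩ =>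
    ⟨x, θ, h1.mono fun _ ha => ⟨h ha.1, ha.2⟩, h2.mono fun _ ha => ⟨h ha.1, ha.2⟩⟩

theorem TreeShatters.nonempty : ∀ {d : ℕ} {A : Set ι}, TreeShatters F ε d A → A.Nonempty
  | 0, _, h => h
  | _ + 1, _, ⟨_, _, h, _⟩ => h.nonempty.mono fun _ ha => ha.1

/-- The subtree below the child `c` of the root. -/
def LabelledTree.child {d : ℕ} (T : LabelledTree X (d + 1)) (c : Bool) : LabelledTree X d where
  point i b := T.point i.succ (Fin.cons c b : Fin (i + 1) → Bool)
  witness i b := T.witness i.succ (Fin.cons c b : Fin (i + 1) → Bool)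
  leaf b := T.leaf (Fin.cons c b : Fin (d + 1) → Bool)

/-- The tree with a given root and given subtrees below its children. -/
def LabelledTree.node {d : ℕ} (x : X) (θ : ℝ) (T : Bool → LabelledTree X d) :
    LabelledTree X (d + 1) where
  point := Fin.cases (fun _ => x) fun i (b : Fin (i + 1) → Bool) =>
    (T (b 0)).point i (Fin.tail b)
  witness := Fin.cases (fun _ => θ) fun i (b : Fin (i + 1) → Bool) =>
    (T (b 0)).witness i (Fin.tail b)
  leaf b := (T (b 0)).leaf (Fin.tail b)

theorem nodeOnPath_cons {d : ℕ} (c : Bool) (b : Fin d → Bool) (i : Fin d) :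
    nodeOnPath (Fin.cons c b : Fin (d + 1) → Bool) i.succ =
      (Fin.cons c (nodeOnPath b i) : Fin (i + 1) → Bool) := by
  funext j
  refine Fin.cases ?_ (fun j => ?_) j <;> rfl

theorem LabelledTree.IsShattered.treeShatters : ∀ {d : ℕ} {A : Set ι} (T : LabelledTree X d),
    T.IsShattered (F '' A) ε → TreeShatters F ε d A
  | 0, _, _, h => by
    obtain ⟨a, ha, -⟩ := h.1 Fin.elim0
    exact ⟨a, ha⟩
  | d + 1, A, T, h => by
    have hnode : ∀ b : Fin (d + 1) → Bool, nodeOnPath b 0 = Fin.elim0 := fun b =>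
      funext fun j => j.elim0
    have hchild : ∀ (c : Bool) (B : Set ι),
        (∀ b a, F a = T.leaf (Fin.cons c b : Fin (d + 1) → Bool) → a ∈ A → a ∈ B) →
        TreeShatters F ε d B := by
      intro c B hB
      refine LabelledTree.IsShattered.treeShatters (T.child c) ⟨fun b => ?_, fun b i => ?_⟩
      · obtain ⟨a, ha, hab⟩ := h.1 (Fin.cons c b)
        exact ⟨a, hB b a hab ha, hab⟩
      · have := h.2 (Fin.cons c b) i.succ
        rwa [nodeOnPath_cons, Fin.cons_succ] at this
    refine ⟨T.point 0 Fin.elim0, T.witness 0 Fin.elim0, hchild true _ fun b a hab ha => ?_,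
      hchild false _ fun b a hab ha => ?_⟩
    · have := (h.2 (Fin.cons true b) 0).1 rfl
      rw [hnode, ← hab] at this
      exact ⟨ha, this⟩
    · have := (h.2 (Fin.cons false b) 0).2 rfl
      rw [hnode, ← hab] at this
      exact ⟨ha, this⟩

theorem TreeShatters.exists_isShattered : ∀ {d : ℕ} {A : Set ι}, TreeShatters F ε d A →
    ∃ T : LabelledTree X d, T.IsShattered (F '' A) ε
  | 0, _, ⟨a, ha⟩ => ⟨⟨fun i => i.elim0, fun i => i.elim0, fun _ => F a⟩,
      fun _ => ⟨a, ha, rfl⟩, fun _ i => i.elim0⟩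
  | d + 1, A, ⟨x, θ, h1, h2⟩ => by
    obtain ⟨T₁, hT₁⟩ := h1.exists_isShattered
    obtain ⟨T₂, hT₂⟩ := h2.exists_isShattered
    refine ⟨LabelledTree.node x θ fun c => bif c then T₁ else T₂, fun b => ?_, fun b i => ?_⟩
    · rw [← Fin.cons_self_tail b]
      cases b 0
      · exact Set.image_mono (fun _ ha => ha.1) (hT₂.1 (Fin.tail b))
      · exact Set.image_mono (fun _ ha => ha.1) (hT₁.1 (Fin.tail b))
    · rw [← Fin.cons_self_tail b]
      generalize Fin.tail b = t
      refine Fin.cases ?_ (fun i => ?_) i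
      · cases b 0
        · refine ⟨fun h => by simp at h, fun _ => ?_⟩
          obtain ⟨a, ha, hab⟩ := hT₂.1 t
          have := ha.2
          rw [hab] at this
          exact this
        · refine ⟨fun _ => ?_, fun h => by simp at h⟩
          obtain ⟨a, ha, hab⟩ := hT₁.1 t
          have := ha.2
          rw [hab] at this
          exact this
      · rw [nodeOnPath_cons, Fin.cons_succ]
        cases b 0
        · exact hT₂.2 t i
        · exact hT₁.2 t i

open Classical in
/-- One more than the largest depth up to `r` of a tree shattered by `A`, and `0` if `A` is
empty. -/
noncomputable def treeRank (F : ι → X → ℝ) (ε : ℝ) (r : ℕ) (A : Set ι) : ℕ :=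
  ((Finset.range (r + 1)).filter fun d => TreeShatters F ε d A).sup (· + 1)

theorem treeRank_le (r : ℕ) (A : Set ι) : treeRank F ε r A ≤ r + 1 := by
  classical
  refine Finset.sup_le fun d hd => ?_
  have := Finset.mem_range.1 (Finset.mem_filter.1 hd).1
  omega

theorem TreeShatters.lt_treeRank {d r : ℕ} {A : Set ι} (h : TreeShatters F ε d A) (hd : d ≤ r) :
    d < treeRank F ε r A := by
  classical
  exact Finset.le_sup (s := (Finset.range (r + 1)).filter fun d => TreeShatters F ε d A)
    (f := (· + 1)) (Finset.mem_filter.2 ⟨Finset.mem_range.2 (Nat.lt_succ_of_le hd), h⟩)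

theorem treeRank_mono (r : ℕ) {A B : Set ι} (h : A ⊆ B) :
    treeRank F ε r A ≤ treeRank F ε r B := by
  classical
  refine Finset.sup_le fun d hd => ?_
  obtain ⟨h1, h2⟩ := Finset.mem_filter.1 hd
  exact (h2.mono h).lt_treeRank (Nat.lt_succ_iff.1 (Finset.mem_range.1 h1))

/-- A positive rank is attained, as the supremum runs over a finite nonempty set of depths. -/
theorem treeShatters_of_treeRank_eq {r m : ℕ} {A : Set ι} (h : treeRank F ε r A = m + 1) :
    TreeShatters F ε m A := by
  classical
  by_contra hm
  have hne : ((Finset.range (r + 1)).filter fun d => TreeShatters F ε d A).Nonempty := by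
    rw [Finset.nonempty_iff_ne_empty]
    intro h0
    simp only [treeRank, h0, Finset.sup_empty, bot_eq_zero'] at h
    omega
  obtain ⟨d, hd, hd'⟩ := Finset.exists_mem_eq_sup _ hne (· + 1)
  have : treeRank F ε r A = d + 1 := hd'
  obtain rfl : d = m := by omega
  exact hm (Finset.mem_filter.1 hd).2

/-- Splitting at a point increases the rank if both halves have the same positive rank. -/
theorem lt_treeRank_of_eq {r : ℕ} {A A₁ A₂ : Set ι} (hr : ∀ d, TreeShatters F ε d A → d ≤ r)
    (x : X) (θ : ℝ) (h₁ : A₁ ⊆ {a ∈ A | θ + ε ≤ F a x}) (h₂ : A₂ ⊆ {a ∈ A | F a x ≤ θ})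
    (heq : treeRank F ε r A₁ = treeRank F ε r A₂) (hpos : 0 < treeRank F ε r A₁) :
    treeRank F ε r A₁ < treeRank F ε r A := by
  obtain ⟨m, hm⟩ := Nat.exists_eq_add_one.2 hpos
  have h : TreeShatters F ε (m + 1) A :=
    ⟨x, θ, (treeShatters_of_treeRank_eq hm).mono h₁,
      (treeShatters_of_treeRank_eq (heq ▸ hm)).mono h₂⟩
  rw [hm]
  exact h.lt_treeRank (hr _ h)

end TreeShatters

/-! ### Sequential fat shattering -/

namespace Game

variable {k : ℕ} (G : Game.{v} k)

/-- The profiles at which the utility of `p` lies in the interval `[c ε, (c + 1) ε)`. -/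
def utilityLevel (ε : ℝ) (p : Fin k) (c : ℕ) : Set G.Profile :=
  {a | ⌊G.utility p a / ε⌋₊ = c}

theorem utility_bounds_of_mem_utilityLevel (hu : ∀ p a, G.utility p a ∈ Set.Icc (0 : ℝ) 1)
    {ε : ℝ} (hε : 0 < ε) {p : Fin k} {c : ℕ} {a : G.Profile} (ha : a ∈ G.utilityLevel ε p c) :
    c * ε ≤ G.utility p a ∧ G.utility p a ≤ c * ε + ε := by
  obtain ⟨h1, h2⟩ := (Nat.floor_eq_iff (div_nonneg (hu p a).1 hε.le)).1 ha
  rw [le_div_iff₀ hε] at h1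
  rw [div_lt_iff₀ hε] at h2
  constructor <;> linarith

theorem floor_utility_div_mem_range (hu : ∀ p a, G.utility p a ∈ Set.Icc (0 : ℝ) 1)
    {ε : ℝ} (hε : 0 < ε) (p : Fin k) (a : G.Profile) :
    ⌊G.utility p a / ε⌋₊ ∈ Finset.range (⌊1 / ε⌋₊ + 1) := by
  rw [Finset.mem_range, Nat.lt_succ_iff]
  exact Nat.floor_le_floor (div_le_div_of_nonneg_right (hu p a).2 hε.le)

/-- The depth of a tree shattered by the CCE matrix is at most the sum of the ranks of its
profiles over all players and utility levels. -/
theorem le_sum_treeRank_of_treeShatters_cceMatrix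
    (hu : ∀ p a, G.utility p a ∈ Set.Icc (0 : ℝ) 1) {ε : ℝ} (hε : 0 < ε) {r : ℕ}
    (hr : ∀ p d, TreeShatters (G.deviation p) ε d Set.univ → d ≤ r) :
    ∀ {d : ℕ} {A : Set G.Profile}, TreeShatters G.cceMatrix (2 * ε) d A →
      d ≤ ∑ q ∈ (Finset.univ : Finset (Fin k)) ×ˢ Finset.range (⌊1 / ε⌋₊ + 1),
        treeRank (G.deviation q.1) ε r (A ∩ G.utilityLevel ε q.1 q.2)
  | 0, _, _ => Nat.zero_le _
  | d + 1, A, ⟨⟨p, x⟩, θ, h1, h2⟩ => by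
    have ih1 := le_sum_treeRank_of_treeShatters_cceMatrix hu hε hr h1
    have ih2 := le_sum_treeRank_of_treeShatters_cceMatrix hu hε hr h2
    set A₁ := {a ∈ A | θ + 2 * ε ≤ G.cceMatrix a ⟨p, x⟩}
    set A₂ := {a ∈ A | G.cceMatrix a ⟨p, x⟩ ≤ θ}
    have hA₁ : A₁ ⊆ A := fun _ ha => ha.1
    have hA₂ : A₂ ⊆ A := fun _ ha => ha.1
    obtain ⟨a, ha⟩ := h1.nonempty
    -- This level meets `A₁`, so its rank there is positive. If the children's ranks at `(p, c)`
    -- differ, the child with the smaller one loses rank; if they agree, both lie strictly below the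
    -- parent's.
    set c := ⌊G.utility p a / ε⌋₊ with hc
    have hq : (p, c) ∈ (Finset.univ : Finset (Fin k)) ×ˢ Finset.range (⌊1 / ε⌋₊ + 1) :=
      Finset.mem_product.2 ⟨Finset.mem_univ _, G.floor_utility_div_mem_range hu hε p a⟩
    have hmono : ∀ {B : Set G.Profile}, B ⊆ A → ∀ q : Fin k × ℕ,
        treeRank (G.deviation q.1) ε r (B ∩ G.utilityLevel ε q.1 q.2) ≤
          treeRank (G.deviation q.1) ε r (A ∩ G.utilityLevel ε q.1 q.2) := fun h q =>
      treeRank_mono r (Set.inter_subset_inter_left _ h)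
    rcases lt_trichotomy (treeRank (G.deviation p) ε r (A₁ ∩ G.utilityLevel ε p c))
      (treeRank (G.deviation p) ε r (A₂ ∩ G.utilityLevel ε p c)) with hlt | heq | hlt
    · exact ih1.trans_lt (Finset.sum_lt_sum (fun q _ => hmono hA₁ q)
        ⟨(p, c), hq, hlt.trans_le (hmono hA₂ (p, c))⟩)
    · refine ih1.trans_lt (Finset.sum_lt_sum (fun q _ => hmono hA₁ q) ⟨(p, c), hq, ?_⟩)
      refine lt_treeRank_of_eq (fun d hd => hr p d (hd.mono (Set.subset_univ _))) x
        (θ + c * ε + ε) (fun b hb => ?_) (fun b hb => ?_) heq ?_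
      · refine ⟨⟨hb.1.1, hb.2⟩, ?_⟩
        have h3 := hb.1.2
        rw [cceMatrix_mk] at h3
        linarith [(G.utility_bounds_of_mem_utilityLevel hu hε hb.2).1]
      · refine ⟨⟨hb.1.1, hb.2⟩, ?_⟩
        have h3 := hb.1.2
        rw [cceMatrix_mk] at h3
        linarith [(G.utility_bounds_of_mem_utilityLevel hu hε hb.2).2]
      · exact TreeShatters.lt_treeRank (d := 0) ⟨a, ha, rfl⟩ (Nat.zero_le _)
    · exact ih2.trans_lt (Finset.sum_lt_sum (fun q _ => hmono hA₂ q)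
        ⟨(p, c), hq, hlt.trans_le (hmono hA₁ (p, c))⟩)

theorem sfatDim_cceClass_le (hu : ∀ p a, G.utility p a ∈ Set.Icc (0 : ℝ) 1)
    {ε : ℝ} (hε : 0 < ε) :
    (sfatDim G.cceClass (2 * ε) : ENNReal) ≤
      ENNReal.ofReal (4 * (k / ε)) * ((max (G.sfat ε) 1 : ℕ∞) : ENNReal) := by
  refine ENat.toENNReal_iSup_prop_le fun n hn => ?_
  obtain ⟨T, hT⟩ := hn
  rw [cceClass, ← Set.image_univ] at hT
  have hn := hT.treeShatters
  rcases Nat.eq_zero_or_pos n with rfl | hn0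
  · simp
  obtain ⟨m, rfl⟩ := Nat.exists_eq_add_one.2 hn0
  -- Entries of the matrix lie in `[-1, 1]`, so a nontrivial tree forces `2ε ≤ 2`.
  have hε1 : ε ≤ 1 := by
    obtain ⟨⟨p, x⟩, θ, h1, h2⟩ := hn
    obtain ⟨a, -, ha⟩ := h1.nonempty
    obtain ⟨b, -, hb⟩ := h2.nonempty
    rw [cceMatrix_mk] at ha hb
    have h3 : G.deviation p a x ∈ Set.Icc (0 : ℝ) 1 := hu _ _
    have h4 : G.deviation p b x ∈ Set.Icc (0 : ℝ) 1 := hu _ _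
    linarith [h3.2, h4.1, (hu p a).1, (hu p b).2]
  have hk : 0 < k := by
    obtain ⟨⟨p, -⟩, -⟩ := hn
    exact p.pos
  by_cases htop : G.sfat ε = ⊤
  · have : 0 < 4 * ((k : ℝ) / ε) := by positivity
    rw [htop, max_eq_left le_top, ENat.toENNReal_top,
      ENNReal.mul_top (ENNReal.ofReal_pos.2 this).ne']
    exact le_top
  obtain ⟨r, hr⟩ := ENat.ne_top_iff_exists.1 htop
  have hr' : ∀ p d, TreeShatters (G.deviation p) ε d Set.univ → d ≤ r := by
    intro p d hd
    obtain ⟨T, hT⟩ := hd.exists_isShattered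
    rw [Set.image_univ] at hT
    exact ENat.le_of_iSup_iSup_prop_eq hr.symm (p := p)
      ⟨T, fun b => G.range_deviation_subset p (hT.1 b), hT.2⟩
  have hmax : (max (G.sfat ε) 1 : ℕ∞) = (max r 1 : ℕ) := by
    rw [← hr]
    rfl
  rw [hmax, ENat.toENNReal_coe, ← ENNReal.ofReal_natCast, ← ENNReal.ofReal_natCast (n := max r 1),
    ← ENNReal.ofReal_mul (by positivity)]
  apply ENNReal.ofReal_le_ofReal
  have hle := (G.le_sum_treeRank_of_treeShatters_cceMatrix hu hε hr' hn).trans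
    (Finset.sum_le_card_nsmul _ _ (r + 1) fun q _ => treeRank_le r _)
  rw [Finset.card_product, Finset.card_univ, Fintype.card_fin, Finset.card_range,
    smul_eq_mul] at hle
  have hfl : ((⌊1 / ε⌋₊ + 1 : ℕ) : ℝ) ≤ 2 / ε := by
    have h1 := Nat.floor_le (a := 1 / ε) (by positivity)
    have h2 : 1 ≤ 1 / ε := (one_le_div hε).2 hε1
    have h3 : 2 / ε = 1 / ε + 1 / ε := by ring
    push_cast
    linarith
  have hr2 : ((r + 1 : ℕ) : ℝ) ≤ 2 * (max r 1 : ℕ) := by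
    have : r + 1 ≤ 2 * max r 1 := by omega
    exact_mod_cast this
  calc ((m + 1 : ℕ) : ℝ) ≤ k * (⌊1 / ε⌋₊ + 1 : ℕ) * (r + 1 : ℕ) := by exact_mod_cast hle
    _ ≤ k * (2 / ε) * (2 * (max r 1 : ℕ)) := by gcongr
    _ = 4 * (k / ε) * (max r 1 : ℕ) := by ring

end Game

/-! ### Fat shattering -/

/-- Weighting the terms by `4 ^ (d - i) ≥ 1` completes them to the binomial expansion of `(1 + 1/4)
^ n`. Since `5/4 < 2`, comparison with `2 ^ n` gives a bound on `n` linear in `d`. -/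
theorem sum_Iic_choose_mul_le (n d : ℕ) :
    ((∑ i ∈ Finset.Iic d, n.choose i : ℕ) : ℝ) ≤ 4 ^ d * (5 / 4) ^ n := by
  have h1 : ∀ i ∈ Finset.Iic d, (n.choose i : ℝ) ≤ 4 ^ d * ((1 / 4) ^ i * n.choose i) := by
    intro i hi
    have h2 : (4 : ℝ) ^ i ≤ 4 ^ d := pow_le_pow_right₀ (by norm_num) (Finset.mem_Iic.1 hi)
    have h3 : (1 : ℝ) ≤ 4 ^ d * (1 / 4) ^ i := by
      rw [one_div, inv_pow, ← div_eq_mul_inv]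
      exact (one_le_div (by positivity)).2 h2
    rw [← mul_assoc]
    exact le_mul_of_one_le_left (by positivity) h3
  have h4 : ∑ i ∈ Finset.Iic d, ((1 / 4 : ℝ) ^ i * n.choose i) ≤ (5 / 4) ^ n := by
    have h5 : ((5 : ℝ) / 4) ^ n = ∑ i ∈ Finset.range (n + 1), (1 / 4 : ℝ) ^ i * n.choose i := by
      have := add_pow (1 / 4 : ℝ) 1 n
      norm_num at this ⊢
      exact this
    rw [h5, ← Finset.sum_filter_add_sum_filter_not (Finset.Iic d) (· ∈ Finset.range (n + 1))]
    have h6 : ∑ i ∈ (Finset.Iic d).filter (¬ · ∈ Finset.range (n + 1)),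
        ((1 / 4 : ℝ) ^ i * n.choose i) = 0 := by
      refine Finset.sum_eq_zero fun i hi => ?_
      have : n < i := by
        have := (Finset.mem_filter.1 hi).2
        rw [Finset.mem_range] at this
        omega
      simp [Nat.choose_eq_zero_of_lt this]
    rw [h6, add_zero]
    refine Finset.sum_le_sum_of_subset_of_nonneg (fun i hi => (Finset.mem_filter.1 hi).2) ?_
    intros
    positivity
  push_cast
  refine (Finset.sum_le_sum h1).trans ?_
  rw [← Finset.mul_sum]
  gcongr

theorem FatShatters.mono {X : Type*} {F : Set (X → ℝ)} {ε δ : ℝ} {d : ℕ} (hεδ : ε ≤ δ)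
    (h : FatShatters F δ d) : FatShatters F ε d := by
  obtain ⟨x, θ, hx, h⟩ := h
  refine ⟨x, θ, hx, fun b => ?_⟩
  obtain ⟨f, hf, h⟩ := h b
  exact ⟨f, hf, fun j => ⟨fun hb => by linarith [(h j).1 hb], (h j).2⟩⟩

/-- The Sauer–Shelah bound for the patterns that a class realizes with margin `ε`. -/
theorem card_le_sum_choose_of_fatShatters {X : Type*} {F : Set (X → ℝ)} {ε : ℝ} {m d : ℕ}
    (hd : ∀ n, FatShatters F ε n → n ≤ d) {x : Fin m → X} (hx : Function.Injective x)
    (θ : Fin m → ℝ) (𝒜 : Finset (Finset (Fin m)))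
    (h𝒜 : ∀ s ∈ 𝒜, ∃ f ∈ F, ∀ j, (j ∈ s → θ j + ε ≤ f (x j)) ∧ (j ∉ s → f (x j) ≤ θ j)) :
    𝒜.card ≤ ∑ i ∈ Finset.Iic d, m.choose i := by
  -- A set shattered by the family of patterns is fat-shattered by `F`, with the same witnesses.
  have hvc : 𝒜.vcDim ≤ d := by
    refine Finset.sup_le fun s hs => hd _ ?_
    rw [Finset.mem_shatterer] at hs
    let e := s.equivFin.symm
    refine ⟨fun j => x (e j), fun j => θ (e j),
      hx.comp (Subtype.val_injective.comp e.injective), fun b => ?_⟩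
    obtain ⟨u, hu, hsu⟩ := hs (t := (Finset.univ.filter fun j => b j = true).image
      fun j => (e j : Fin m)) (by
        intro i hi
        obtain ⟨j, -, rfl⟩ := Finset.mem_image.1 hi
        exact (e j).2)
    have hmem : ∀ j, (e j : Fin m) ∈ u ↔ b j = true := by
      intro j
      have h1 : (e j : Fin m) ∈ s ∩ u ↔ (e j : Fin m) ∈ u := by simp
      rw [← h1, hsu]
      simp
    obtain ⟨f, hf, h⟩ := h𝒜 u hu
    refine ⟨f, hf, fun j => ⟨fun hb => (h _).1 ((hmem j).2 hb), fun hb => (h _).2 ?_⟩⟩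
    rw [hmem, hb]
    simp
  refine (Finset.card_le_card_shatterer 𝒜).trans
    ((Finset.card_shatterer_le_sum_vcDim (𝒜 := 𝒜)).trans ?_)
  rw [Fintype.card_fin]
  exact Finset.sum_le_sum_of_subset (Finset.Iic_subset_Iic.2 hvc)

namespace Game

variable {k : ℕ} (G : Game.{v} k)

/-- The number of columns of one player in a set shattered by the CCE matrix. -/
theorem two_pow_card_player_le (hu : ∀ p a, G.utility p a ∈ Set.Icc (0 : ℝ) 1)
    {n d : ℕ} {ε : ℝ} (hε : 0 < ε) {x : Fin n → Σ p, G.Action p} (hx : Function.Injective x)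
    (θ : Fin n → ℝ)
    (h : ∀ b : Fin n → Bool, ∃ a : G.Profile, ∀ j,
      (b j = true → θ j + 2 * ε ≤ G.cceMatrix a (x j)) ∧
        (b j = false → G.cceMatrix a (x j) ≤ θ j))
    (p : Fin k) (hd : ∀ m, FatShatters (G.utilityClass p) ε m → m ≤ d)
    (S : Finset (Fin n)) (hp : ∀ j ∈ S, (x j).1 = p) :
    2 ^ S.card ≤ (∑ i ∈ Finset.Iic d, S.card.choose i) * (⌊1 / ε⌋₊ + 1) := by
  let e := S.orderEmbOfFin rfl
  have hy : ∀ t, ∃ y : G.Action p, x (e t) = ⟨p, y⟩ := by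
    intro t
    have := hp _ (S.orderEmbOfFin_mem rfl t)
    change (x (e t)).1 = p at this
    generalize x (e t) = z at *
    obtain ⟨q, z⟩ := z
    subst this
    exact ⟨z, rfl⟩
  choose y hy using hy
  have hyinj : Function.Injective y := by
    intro i j hij
    apply e.injective
    apply hx
    rw [hy, hy, hij]
  have hpat : ∀ s : Finset (Fin S.card), ∃ a : G.Profile, ∀ j,
      (j ∈ s → θ (e j) + 2 * ε ≤ G.deviation p a (y j) - G.utility p a) ∧
        (j ∉ s → G.deviation p a (y j) - G.utility p a ≤ θ (e j)) := by
    intro s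
    classical
    obtain ⟨a, ha⟩ := h fun i => decide (i ∈ s.map e.toEmbedding)
    refine ⟨a, fun j => ?_⟩
    have := ha (e j)
    rw [hy, cceMatrix_mk] at this
    simpa using this
  choose a ha using hpat
  -- One profile is chosen per pattern. Those in one level realize their patterns with margin `ε` in
  -- the utility class, so Sauer–Shelah bounds their number.
  have := Finset.card_le_mul_card_image_of_maps_to
    (s := (Finset.univ : Finset (Finset (Fin S.card))))
    (f := fun s => ⌊G.utility p (a s) / ε⌋₊)
    (fun s _ => G.floor_utility_div_mem_range hu hε p (a s))
    (∑ i ∈ Finset.Iic d, S.card.choose i) ?_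
  · simpa using this
  · intro c _
    refine card_le_sum_choose_of_fatShatters hd hyinj (fun j => θ (e j) + c * ε + ε) _ ?_
    intro s hs
    have hs : a s ∈ G.utilityLevel ε p c := (Finset.mem_filter.1 hs).2
    have hb := G.utility_bounds_of_mem_utilityLevel hu hε hs
    refine ⟨_, G.deviation_mem_utilityClass p (a s), fun j => ⟨fun hj => ?_, fun hj => ?_⟩⟩
    · linarith [(ha s j).1 hj]
    · linarith [(ha s j).2 hj]

end Game

/-- Taking logarithms gives a bound of order `D + log (1/ε)`, stronger than the stated product. The
assumption `ε ≤ 1/8` keeps `log (1/ε)` above `2`, so the product dominates both terms. -/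
theorem le_of_two_pow_le_sum_choose {n d : ℕ} {ε : ℝ} (hε : 0 < ε) (hε1 : ε ≤ 1 / 8)
    (h : 2 ^ n ≤ (∑ i ∈ Finset.Iic d, n.choose i) * (⌊1 / ε⌋₊ + 1)) :
    (n : ℝ) ≤ 10 * (max (d : ℝ) 2 * Real.log (max (d : ℝ) 2) * Real.log (1 / ε) ^ 2) := by
  set D := max (d : ℝ) 2
  set L := Real.log (1 / ε) with hL
  have hD2 : (2 : ℝ) ≤ D := le_max_right _ _
  have hdD : (d : ℝ) ≤ D := le_max_left _ _
  have hlog2 := Real.log_two_gt_d9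
  have hlog2' := Real.log_two_lt_d9
  have h8 : 8 ≤ 1 / ε := by
    rw [le_div_iff₀ hε]
    linarith
  have hL2 : 2 ≤ L := by
    have h1 : Real.log 8 ≤ L := Real.log_le_log (by norm_num) h8
    have h2 : Real.log 8 = 3 * Real.log 2 := by
      rw [show (8 : ℝ) = 2 ^ 3 by norm_num, Real.log_pow]
      norm_num
    linarith
  have hlogD : Real.log 2 ≤ Real.log D := Real.log_le_log (by norm_num) hD2
  have hN : ((⌊1 / ε⌋₊ + 1 : ℕ) : ℝ) ≤ 2 * (1 / ε) := by
    have h1 := Nat.floor_le (a := 1 / ε) (by positivity)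
    push_cast
    linarith
  have h1 : (2 : ℝ) ^ n ≤ 4 ^ d * (5 / 4) ^ n * (2 * (1 / ε)) := by
    calc (2 : ℝ) ^ n ≤ ((∑ i ∈ Finset.Iic d, n.choose i : ℕ) : ℝ) * (⌊1 / ε⌋₊ + 1 : ℕ) := by
          exact_mod_cast h
      _ ≤ _ := mul_le_mul (sum_Iic_choose_mul_le n d) hN (by positivity) (by positivity)
  have h2 := Real.log_le_log (by positivity) h1
  rw [Real.log_mul (by positivity) (by positivity), Real.log_mul (by positivity) (by positivity),
    Real.log_mul (by positivity) (by positivity), Real.log_pow, Real.log_pow, Real.log_pow,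
    ← hL] at h2
  have h4 : Real.log 4 = 2 * Real.log 2 := by
    rw [show (4 : ℝ) = 2 ^ 2 by norm_num, Real.log_pow]
    norm_num
  have h5 : Real.log (5 / 4) ≤ 1 / 4 := by
    have := Real.log_le_sub_one_of_pos (show (0 : ℝ) < 5 / 4 by norm_num)
    linarith
  have hn0 : (0 : ℝ) ≤ n := Nat.cast_nonneg n
  have hd0 : (0 : ℝ) ≤ d := Nat.cast_nonneg d
  -- The coefficient of `n` is `log 2 - log (5/4)`, which exceeds `0.4`.
  have h6 : (n : ℝ) * 0.4 ≤ 1.4 * d + 0.7 + L := by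
    rw [h4] at h2
    nlinarith
  have h7 : (n : ℝ) ≤ 3.5 * D + 4 * L := by linarith
  have hDlog : 0.69 * D ≤ D * Real.log D := by nlinarith
  have hL4 : 2 * L ≤ L ^ 2 := by nlinarith
  have h8' : 0.69 * D * L ^ 2 ≤ D * Real.log D * L ^ 2 :=
    mul_le_mul_of_nonneg_right hDlog (sq_nonneg L)
  have h9 : D * 4 ≤ D * L ^ 2 := mul_le_mul_of_nonneg_left (by nlinarith) (by linarith)
  have h10 : 2 * L ^ 2 ≤ D * L ^ 2 := mul_le_mul_of_nonneg_right hD2 (sq_nonneg L)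
  linarith

namespace Game

variable {k : ℕ} (G : Game.{v} k)

theorem fatDim_cceClass_le (hu : ∀ p a, G.utility p a ∈ Set.Icc (0 : ℝ) 1)
    {ε : ℝ} (hε : 0 < ε) {d : ℕ} (hd : G.fat ε = d) :
    (fatDim G.cceClass (16 * ε) : ENNReal) ≤
      ENNReal.ofReal (10 * (k * max (d : ℝ) 2 * Real.log (max (d : ℝ) 2) *
        Real.log (1 / ε) ^ 2)) := by
  refine ENat.toENNReal_iSup_prop_le fun n hn => ?_
  rcases Nat.eq_zero_or_pos n with rfl | hn0
  · simp
  -- Margin `16ε` must fit in `[-1, 1]`. This is the only use of the factor `16`; afterwards margin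
  -- `2ε` suffices.
  have hε1 : ε ≤ 1 / 8 := by
    obtain ⟨x, θ, -, h⟩ := hn
    obtain ⟨_, ⟨a, rfl⟩, ha⟩ := h fun _ => true
    obtain ⟨_, ⟨b, rfl⟩, hb⟩ := h fun _ => false
    have ha := (ha ⟨0, hn0⟩).1 rfl
    have hb := (hb ⟨0, hn0⟩).2 rfl
    generalize x ⟨0, hn0⟩ = z at *
    obtain ⟨p, z⟩ := z
    rw [cceMatrix_mk] at ha hb
    have h3 : G.deviation p a z ∈ Set.Icc (0 : ℝ) 1 := hu _ _
    have h4 : G.deviation p b z ∈ Set.Icc (0 : ℝ) 1 := hu _ _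
    linarith [h3.2, h4.1, (hu p a).1, (hu p b).2]
  obtain ⟨x, θ, hx, h⟩ := hn.mono (show 2 * ε ≤ 16 * ε by linarith)
  have h' : ∀ b : Fin n → Bool, ∃ a : G.Profile, ∀ j,
      (b j = true → θ j + 2 * ε ≤ G.cceMatrix a (x j)) ∧
        (b j = false → G.cceMatrix a (x j) ≤ θ j) := by
    intro b
    obtain ⟨_, ⟨a, rfl⟩, ha⟩ := h b
    exact ⟨a, ha⟩
  rw [← ENNReal.ofReal_natCast]
  apply ENNReal.ofReal_le_ofReal
  have hsum := Finset.card_eq_sum_card_fiberwise (s := (Finset.univ : Finset (Fin n)))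
    (t := (Finset.univ : Finset (Fin k))) (f := fun j => (x j).1) (by simp)
  rw [Finset.card_univ, Fintype.card_fin] at hsum
  calc (n : ℝ) = ∑ p : Fin k, ((Finset.univ.filter fun j => (x j).1 = p).card : ℝ) := by
        exact_mod_cast hsum
    _ ≤ ∑ _p : Fin k, 10 * (max (d : ℝ) 2 * Real.log (max (d : ℝ) 2) * Real.log (1 / ε) ^ 2) :=
        Finset.sum_le_sum fun p _ => le_of_two_pow_le_sum_choose hε hε1
          (G.two_pow_card_player_le hu hε hx θ h' p
            (fun m hm => ENat.le_of_iSup_iSup_prop_eq hd hm) _ (by simp))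
    _ = _ := by
        rw [Finset.sum_const, Finset.card_univ, Fintype.card_fin, nsmul_eq_mul]
        ring

end Game

theorem mainTheorem7 :
    ∃ C : ℝ, 0 < C ∧ ∀ (k : ℕ) (G : Game.{v} k),
      (∀ (p : Fin k) (a : G.Profile), G.utility p a ∈ Set.Icc (0 : ℝ) 1) →
      ∀ ε : ℝ, 0 < ε →
        (∀ d : ℕ, G.fat ε = d →
          (fatDim G.cceClass (16 * ε) : ENNReal) ≤
            ENNReal.ofReal (C * (k * max (d : ℝ) 2 * Real.log (max (d : ℝ) 2) *
              Real.log (1 / ε) ^ 2))) ∧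
        ((sfatDim G.cceClass (2 * ε) : ENNReal) ≤
          ENNReal.ofReal (C * (k / ε)) * ((max (G.sfat ε) 1 : ℕ∞) : ENNReal)) ∧
        (ε ≤ 1 →
          (fatrDim G.cceClass (2 * ε) : ENNReal) ≤
            ENNReal.ofReal (k / ε) * (G.fatr ε : ENNReal)) := by
  -- The fat bound needs `10`; the sequential one needs only `4` and is relaxed.
  refine ⟨10, by norm_num, fun k G hu ε hε =>
    ⟨fun d hd => G.fatDim_cceClass_le hu hε hd, (G.sfatDim_cceClass_le hu hε).trans ?_,
      fun hε1 => G.fatrDim_cceClass_le hu hε hε1⟩⟩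
  gcongr
  norm_num
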